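/- Call a matrix $A\in\mathbb{R}^{n\times n}$ a singular $M$-matrix if $A=sI-B$ for some entrywise nonnegative matrix $B$, where $s=\rho(B)$ is the spectral radius of $B$. An eigenvalue of a matrix is called semisimple if every block in which it appears in the Jordan canonical form has size $1$. If $Z^{-1}AZ=\operatorname{diag}(J_1,\dots,J_p)$ is a Jordan canonical form, $J_k$ being the $m_k\times m_k$ block with eigenvalue $\lambda_k$, and if the derivatives $f^{(j)}(\lambda_k)$, $0\le j<m_k$, exist for all $k$, then $f(A)=Z\operatorname{diag}(f(J_1),\dots,f(J_p))Z^{-1}$, where $f(J_k)$ is the upper triangular Toeplitz matrix with first row $\bigl(f(\lambda_k),f'(\lambda_k),\dots,f^{(m_k-1)}(\lambda_k)/(m_k-1)!\bigr)$. **Theorem.** Let $A\in\mathbb{R}^{n\times n}$ be a singular $M$-matrix with $0$ as a semisimple eigenvalue. Then for every $\alpha\in(0,1]$ there exists a determination of $A^\alpha$ that is a singular $M$-matrix. Namely, the branch $f(z)=z^\alpha$ with cut along the negative real axis, $f(\rho e^{i\theta})=\rho^\alpha e^{i\alpha\theta}$ for $\rho>0$, $\theta\in(-\pi,\pi)$,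 and $f(0)=0$, has the derivatives that the definition of $f(A)$ requires, and the primary matrix function $A^\alpha=f(A)$ is a real matrix and a singular $M$-matrix. -/

import Mathlib

open scoped Topology Nat

noncomputable section

namespace FracPower

/-- The spectral radius of a real square matrix: the largest modulus of its complex eigenvalues.
(`spectralRadius` is `ℝ≥0∞`-valued; it is finite here because the spectrum of a matrix is finite.) -/
def specRadius {n : ℕ} (B : Matrix (Fin n) (Fin n) ℝ) : ℝ :=
  (spectralRadius ℂ (B.map Complex.ofReal)).toReal

/-- `A` is a singular `M`-matrix: `A = s I - B` with `B` entrywise nonnegative and `s = ρ(B)`. -/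
def IsSingularMMatrix {n : ℕ} (A : Matrix (Fin n) (Fin n) ℝ) : Prop :=
  ∃ (s : ℝ) (B : Matrix (Fin n) (Fin n) ℝ),
    (∀ i j, 0 ≤ B i j) ∧ s = specRadius B ∧ A = s • (1 : Matrix (Fin n) (Fin n) ℝ) - B

/-- The `m × m` Jordan block with eigenvalue `μ`. -/
def jordanBlock (m : ℕ) (μ : ℂ) : Matrix (Fin m) (Fin m) ℂ :=
  Matrix.of fun i j => if i = j then μ else if (i : ℕ) + 1 = j then 1 else 0

/-- A Jordan canonical form `Z⁻¹ A Z = diag(J₁, …, J_p)` of a complex matrix `A`. The columns of `Z`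
are indexed by pairs (block, position in the block). -/
structure JordanForm {n : ℕ} (A : Matrix (Fin n) (Fin n) ℂ) where
  /-- the number of blocks -/
  p : ℕ
  /-- the sizes of the blocks -/
  size : Fin p → ℕ
  size_pos : ∀ k, 0 < size k
  /-- the eigenvalues of the blocks -/
  eig : Fin p → ℂ
  Z : Matrix (Fin n) (Σ k, Fin (size k)) ℂ
  Zinv : Matrix (Σ k, Fin (size k)) (Fin n) ℂ
  Z_mul_Zinv : Z * Zinv = 1
  Zinv_mul_Z : Zinv * Z = 1
  conj_eq : Zinv * A * Z = Matrix.blockDiagonal' fun k => jordanBlock (size k) (eig k)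

/-- `μ` is a semisimple eigenvalue of `A`: it is an eigenvalue, and in the Jordan canonical form
every block in which it appears has size `1`. -/
def IsSemisimpleEigenvalue {n : ℕ} (A : Matrix (Fin n) (Fin n) ℂ) (μ : ℂ) : Prop :=
  Module.End.HasEigenvalue (Matrix.toLin' A) μ ∧
    ∀ (J : JordanForm A) (k : Fin J.p), J.eig k = μ → J.size k = 1

/-- The complex derivative `f⁽ʲ⁾(z)` exists: there is nothing to check for `j = 0`, and
`f⁽ʲ⁺¹⁾(z)` exists when `f⁽ʲ⁾` exists around `z` and is differentiable at `z`. -/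
def DerivExists (f : ℂ → ℂ) : ℕ → ℂ → Prop
  | 0, _ => True
  | j + 1, z => (∀ᶠ w in 𝓝 z, DerivExists f j w) ∧ DifferentiableAt ℂ (iteratedDeriv j f) z

/-- `f` applied to the `m × m` Jordan block with eigenvalue `μ`: the upper triangular Toeplitz
matrix with entries `f⁽ʲ⁻ⁱ⁾(μ) / (j - i)!`. -/
def jordanBlockFun (f : ℂ → ℂ) (m : ℕ) (μ : ℂ) : Matrix (Fin m) (Fin m) ℂ :=
  Matrix.of fun i j =>
    if i ≤ j then iteratedDeriv ((j : ℕ) - i) f μ / (((j : ℕ) - i)! : ℂ) else 0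

/-- `F = f(A)` as a primary matrix function: `f` is defined on the spectrum of `A` (the derivatives
of `f` of order less than the block size exist at the eigenvalue of every Jordan block) and
`F = Z diag(f(J₁), …, f(J_p)) Z⁻¹`. The same single-valued `f` is used in every block. -/
def IsMatrixFunction {n : ℕ} (f : ℂ → ℂ) (A F : Matrix (Fin n) (Fin n) ℂ) : Prop :=
  ∃ J : JordanForm A,
    (∀ k, ∀ j < J.size k, DerivExists f j (J.eig k)) ∧
    F = J.Z * (Matrix.blockDiagonal' fun k => jordanBlockFun f (J.size k) (J.eig k)) * J.Zinv

/-- The branch of `z ↦ z^α` with cut along the negative real axis: `ρ e^{iθ} ↦ ρ^α e^{iαθ}` for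
`ρ > 0`, `θ ∈ (-π, π)`, and `0 ↦ 0` (for `α ≠ 0`). -/
def principalPower (α : ℝ) : ℂ → ℂ := fun z => z ^ (α : ℂ)

end FracPower

end

/-!
If `A = s I - B` with `B ≥ 0` and `s = ρ(B)`, every eigenvalue `z` of `A` satisfies `|z - s| ≤ s`.
Fix `t > s`. Then every eigenvalue other than `0` lies in the open disc `|z - t| < t`, on which
`z ^ α` is the sum of its Taylor series
`t ^ α ∑ₖ (α choose k) ((z - t) / t) ^ k`, and `0` lies on the boundary circle. This shift from
`s` to `t` is what makes Perron–Frobenius theory unnecessary: other eigenvalues of `B` of modulus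
`ρ(B)`, semisimple or not, are moved to the interior (`norm_sub_lt_of_norm_sub_le`).

Let `p_N` be the Taylor polynomials. On a Jordan block with nonzero eigenvalue, the entries of
`p_N(J)` are derivatives of `p_N` divided by factorials, which converge to those of `z ^ α` because
the Taylor series converges locally uniformly (`tendsto_hasseDeriv_powerTaylor`). The blocks with
eigenvalue `0` have size `1` by semisimplicity, and `p_N(0) → 0` by Abel's theorem
(`tendsto_powerTaylor_zero`). Hence `p_N(A)` converges to the primary matrix function `A ^ α`
(`tendsto_aeval_powerTaylor`), which is therefore real.

For `0 < α ≤ 1` all the numbers `(-1) ^ (k + 1) (α choose k)`, `k ≥ 1`, are nonnegative and they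
sum to at most `1`. As `t I - A = (t - s) I + B` has nonnegative entries, so has
`t ^ α I - p_N(A)`, and so has the limit `C = t ^ α I - A ^ α`. The same series gives
`|t ^ α - z ^ α| ≤ t ^ α` at the eigenvalues `z` of `A`, so the eigenvalues of `C` have modulus at
most `t ^ α`; and the eigenvalue `0` of `A` gives the eigenvalue `t ^ α` of `C`. Hence
`ρ(C) = t ^ α`.

The existence of a Jordan canonical form is derived from the structure theorem for the torsion
`ℂ[X]`-module defined by the matrix (`nonempty_jordanForm`).
-/

namespace FracPower

open Polynomial Filter

/-! ### Existence of the Jordan canonical form -/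

/-- The cyclic module `ℂ[X] ⧸ (p ^ e)`, `p` irreducible with root `μ`, has as Jordan chain the
classes of `(X - μ) ^ (e - 1), …, X - μ, 1`. -/
theorem exists_jordanBasis_quotient {p : ℂ[X]} (hp : Irreducible p) (e : ℕ) :
    ∃ (μ : ℂ) (b : Module.Basis (Fin e) ℂ (ℂ[X] ⧸ Submodule.span ℂ[X] {p ^ e})),
      ∀ j, (X : ℂ[X]) • b j = ∑ i, jordanBlock e μ i j • b i := by
  have hdeg := IsAlgClosed.degree_eq_one_of_irreducible ℂ hp
  obtain ⟨μ, hμ⟩ := Polynomial.exists_root_of_degree_eq_one hdeg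
  have hdvd : X - C μ ∣ p := dvd_iff_isRoot.mpr hμ
  obtain ⟨q, hq⟩ := hdvd
  have hqu : IsUnit q :=
    (hp.isUnit_or_isUnit hq).resolve_left (irreducible_X_sub_C μ).not_isUnit
  set I := Submodule.span ℂ[X] {p ^ e} with hI
  let v : Fin e → ℂ[X] ⧸ I := fun j => I.mkQ ((X - C μ) ^ (e - 1 - (j : ℕ)))
  have hli : LinearIndependent ℂ v := by
    rw [Fintype.linearIndependent_iff]
    intro g hg j
    have h1 : I.mkQ (∑ j : Fin e, C (g j) * (X - C μ) ^ (e - 1 - (j : ℕ))) = 0 := by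
      rw [← hg, map_sum]
      refine Finset.sum_congr rfl fun j _ => ?_
      rw [← Polynomial.smul_eq_C_mul]
      exact (I.mkQ.restrictScalars ℂ).map_smul _ _
    rw [Submodule.mkQ_apply, Submodule.Quotient.mk_eq_zero, hI,
      Submodule.mem_span_singleton] at h1
    obtain ⟨a, ha⟩ := h1
    have h2 : (X - C μ) ^ e ∣ ∑ j : Fin e, C (g j) * (X - C μ) ^ (e - 1 - (j : ℕ)) := by
      rw [← ha, smul_eq_mul, hq, mul_pow]
      exact Dvd.intro_left (a * q ^ e) (by ring)
    -- The substitution `X ↦ X + μ` turns this into `X ^ e ∣ ∑ j, g j X ^ (e - 1 - j)`.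
    have h3 := map_dvd (taylorAlgHom μ) h2
    simp only [map_pow, map_sub, taylorAlgHom_apply, taylor_X, taylor_C, add_sub_cancel_right,
      map_sum, taylor_mul, taylor_pow] at h3
    have h4 := X_pow_dvd_iff.mp h3 (e - 1 - (j : ℕ)) (by omega)
    rw [finsetSum_coeff, Finset.sum_eq_single j] at h4
    · simpa using h4
    · intro i _ hij
      rw [coeff_C_mul, coeff_X_pow, if_neg, mul_zero]
      intro h
      exact hij (Fin.ext (by omega))
    · simp
  have hnd : p.natDegree = 1 := natDegree_eq_of_degree_eq_some hdeg
  have hrank : Fintype.card (Fin e) = Module.finrank ℂ (ℂ[X] ⧸ I) := by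
    rw [Fintype.card_fin, hI, Ideal.submodule_span_eq, finrank_quotient_span_eq_natDegree,
      natDegree_pow, hnd, mul_one]
  have hspan : ⊤ ≤ Submodule.span ℂ (Set.range v) := by
    rcases Nat.eq_zero_or_pos e with he | he
    · subst he
      have : (I : Submodule ℂ[X] ℂ[X]) = ⊤ := by
        rw [hI, pow_zero]; exact Ideal.span_singleton_one
      intro x _
      have hx : x = 0 := by
        obtain ⟨y, rfl⟩ := I.mkQ_surjective x
        rw [Submodule.mkQ_apply, Submodule.Quotient.mk_eq_zero, this]
        trivial
      rw [hx]; exact Submodule.zero_mem _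
    · have : Nonempty (Fin e) := ⟨⟨0, he⟩⟩
      exact (hli.span_eq_top_of_card_eq_finrank hrank).ge
  refine ⟨μ, Module.Basis.mk hli hspan, fun j => ?_⟩
  simp only [Module.Basis.mk_apply]
  -- For `j = 0` the last term is the class of `(X - μ) ^ e`, which is zero.
  have hshift : (X : ℂ[X]) • v j = μ • v j + I.mkQ ((X - C μ) ^ (e - (j : ℕ))) := by
    have h1 : μ • v j = I.mkQ (C μ * (X - C μ) ^ (e - 1 - (j : ℕ))) := by
      rw [← Polynomial.smul_eq_C_mul]
      exact ((I.mkQ.restrictScalars ℂ).map_smul _ _).symm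
    have h2 : (X : ℂ[X]) • v j = I.mkQ (X * (X - C μ) ^ (e - 1 - (j : ℕ))) := by
      rw [← smul_eq_mul, map_smul]
    rw [h1, h2, ← map_add]
    congr 1
    rw [show e - (j : ℕ) = e - 1 - (j : ℕ) + 1 by omega, pow_succ]
    ring
  have hmat : ∀ i : Fin e, jordanBlock e μ i j • v i
      = (if i = j then μ • v i else 0) + (if (i : ℕ) + 1 = j then v i else 0) := by
    intro i
    simp only [jordanBlock, Matrix.of_apply]
    split_ifs with h1 h2 h2
    · subst h1; omega
    · simp
    · simp
    · simp
  rw [hshift, Finset.sum_congr rfl fun i _ => hmat i, Finset.sum_add_distrib,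
    Finset.sum_ite_eq' Finset.univ j, if_pos (Finset.mem_univ _)]
  congr 1
  by_cases hj : (j : ℕ) = 0
  · have hz : I.mkQ ((X - C μ) ^ (e - (j : ℕ))) = 0 := by
      rw [hj, Nat.sub_zero, Submodule.mkQ_apply, Submodule.Quotient.mk_eq_zero, hI,
        Submodule.mem_span_singleton]
      obtain ⟨u, rfl⟩ := hqu
      refine ⟨((u⁻¹ : ℂ[X]ˣ) : ℂ[X]) ^ e, ?_⟩
      rw [smul_eq_mul, hq, ← mul_pow, mul_comm (X - C μ), ← mul_assoc, Units.inv_mul, one_mul]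
    rw [hz]
    exact (Finset.sum_eq_zero fun i _ => if_neg (by omega)).symm
  · rw [Finset.sum_eq_single (⟨(j : ℕ) - 1, by omega⟩ : Fin e)]
    · rw [if_pos (by simp only []; omega)]
      simp only [v]
      congr 2
      omega
    · intro i _ hij
      rw [if_neg]
      intro h
      exact hij (Fin.ext (by simp only []; omega))
    · simp

/-- The structure theorem for torsion modules over `ℂ[X]`, read as a basis of Jordan chains; chains
of length `0` are still allowed. -/
theorem exists_jordanBasis {V : Type*} [AddCommGroup V] [Module ℂ V] [FiniteDimensional ℂ V]
    (T : V →ₗ[ℂ] V) :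
    ∃ (ι : Type) (_ : Fintype ι) (e : ι → ℕ) (μ : ι → ℂ)
      (b : Module.Basis (Σ i, Fin (e i)) ℂ V),
      ∀ k j, T (b ⟨k, j⟩) = ∑ i, jordanBlock (e k) (μ k) i j • b ⟨k, i⟩ := by
  classical
  obtain ⟨ι, hι, p, hp, e, ⟨f⟩⟩ := Module.equiv_directSum_of_isTorsion
    (Module.AEval.isTorsion_of_finiteDimensional ℂ V T)
  choose μ c hc using fun i => exists_jordanBasis_quotient (hp i) (e i)
  let g : (Π₀ i, ℂ[X] ⧸ Submodule.span ℂ[X] {p i ^ e i}) ≃ₗ[ℂ] V :=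
    (f.symm.restrictScalars ℂ).trans (Module.AEval.of ℂ V T).symm
  refine ⟨ι, hι, e, μ, (DFinsupp.basis c).map g, fun k j => ?_⟩
  have hb : ∀ i, (DFinsupp.basis c) ⟨k, i⟩ = DFinsupp.single k (c k i) := by
    intro i
    apply (DFinsupp.basis c).repr.injective
    rw [Module.Basis.repr_self]
    -- Unfolds the representation map of `DFinsupp.basis`.
    change _ = (sigmaFinsuppLequivDFinsupp ℂ).symm
      (DFinsupp.mapRange.linearEquiv (fun i => (c i).repr) (DFinsupp.single k (c k i)))
    rw [LinearEquiv.eq_symm_apply]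
    simp [sigmaFinsuppLequivDFinsupp]
  have hg : ∀ y, T (g y) = g ((X : ℂ[X]) • y) := by
    intro y
    change T ((Module.AEval.of ℂ V T).symm (f.symm y))
      = (Module.AEval.of ℂ V T).symm (f.symm ((X : ℂ[X]) • y))
    rw [map_smul, Module.AEval.of_symm_X_smul]
    rfl
  simp only [Module.Basis.map_apply]
  rw [hg, hb, ← DFinsupp.single_smul, hc]
  simp only [hb, ← map_smul, ← map_sum]
  congr 1
  rw [← DFinsupp.lsingle_apply (R := ℂ), map_sum]
  simp

/-- Every complex matrix has a Jordan canonical form. -/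
theorem nonempty_jordanForm {n : ℕ} (A : Matrix (Fin n) (Fin n) ℂ) : Nonempty (JordanForm A) := by
  classical
  obtain ⟨ι, hι, e, μ, b, hb⟩ := exists_jordanBasis (Matrix.toLin' A)
  -- Only the chains of positive length become blocks.
  let σ : Fin (Fintype.card {i // 0 < e i}) ≃ {i // 0 < e i} := (Fintype.equivFin _).symm
  let r : (Σ k, Fin (e (σ k))) → Σ i, Fin (e i) := fun x => ⟨σ x.1, x.2⟩
  have hr : Function.Bijective r := by
    constructor
    · rintro ⟨k, x⟩ ⟨l, y⟩ h
      have hkl : k = l := σ.injective (Subtype.ext (congrArg Sigma.fst h))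
      subst hkl
      have hxy : x = y := eq_of_heq (Sigma.mk.inj h).2
      rw [hxy]
    · rintro ⟨i, x⟩
      obtain ⟨k, hk⟩ := σ.surjective ⟨i, x.pos⟩
      have hki : i = σ k := by rw [hk]
      subst hki
      exact ⟨⟨k, x⟩, rfl⟩
  let c : Module.Basis (Σ k, Fin (e (σ k))) ℂ (Fin n → ℂ) :=
    b.reindex (Equiv.ofBijective r hr).symm
  have hc : ∀ k x, c ⟨k, x⟩ = b ⟨σ k, x⟩ := fun k x => by
    simp only [c, Module.Basis.reindex_apply, Equiv.symm_symm]
    rfl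
  refine ⟨⟨_, fun k => e (σ k), fun k => (σ k).2, fun k => μ (σ k),
    (Pi.basisFun ℂ (Fin n)).toMatrix c, c.toMatrix (Pi.basisFun ℂ (Fin n)),
    Module.Basis.toMatrix_mul_toMatrix_flip _ _, Module.Basis.toMatrix_mul_toMatrix_flip _ _, ?_⟩⟩
  have hA : A = LinearMap.toMatrix (Pi.basisFun ℂ (Fin n)) (Pi.basisFun ℂ (Fin n))
      (Matrix.toLin' A) := by
    rw [LinearMap.toMatrix_eq_toMatrix', LinearMap.toMatrix'_toLin']
  conv_lhs => rw [hA]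
  rw [basis_toMatrix_mul_linearMap_toMatrix_mul_basis_toMatrix]
  ext ⟨l, y⟩ ⟨k, x⟩
  rw [LinearMap.toMatrix_apply, hc, hb]
  simp only [← hc, map_sum, map_smul, Module.Basis.repr_self, Finsupp.finsetSum_apply,
    Finsupp.smul_apply, smul_eq_mul]
  by_cases h : l = k
  · subst h
    rw [Matrix.blockDiagonal'_apply_eq, Finset.sum_eq_single y]
    · simp
    · intro i _ hi
      rw [Finsupp.single_eq_of_ne, mul_zero]
      simpa using fun h => hi h.symm
    · simp
  · rw [Matrix.blockDiagonal'_apply_ne _ _ _ h]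
    refine Finset.sum_eq_zero fun i _ => ?_
    rw [Finsupp.single_eq_of_ne, mul_zero]
    intro h'
    exact h (congrArg Sigma.fst h')

/-! ### Polynomials and spectra of matrices in Jordan form -/

theorem jordanBlock_zero_pow_apply (m d : ℕ) (i j : Fin m) :
    (jordanBlock m 0 ^ d) i j = if (i : ℕ) + d = j then 1 else 0 := by
  induction d generalizing i with
  | zero => simp [Matrix.one_apply, Fin.ext_iff]
  | succ d ih =>
    have hJ : ∀ k, jordanBlock m 0 i k = if (i : ℕ) + 1 = k then 1 else 0 := fun k => by
      simp only [jordanBlock, Matrix.of_apply]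
      split_ifs <;> first | rfl | omega
    rw [pow_succ', Matrix.mul_apply]
    simp only [ih, hJ]
    by_cases h : (i : ℕ) + 1 < m
    · rw [Finset.sum_eq_single ⟨i + 1, h⟩]
      · simp [add_assoc, add_comm 1 d]
      · intro k _ hk
        have : ¬ (i : ℕ) + 1 = k := fun h' => hk (Fin.ext h'.symm)
        simp [this]
      · simp
    · rw [if_neg (by omega)]
      refine Finset.sum_eq_zero fun k _ => ?_
      have : ¬ (i : ℕ) + 1 = k := by omega
      simp [this]

/-- A polynomial of a Jordan block: the Taylor coefficients at the eigenvalue fill the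
superdiagonals. -/
theorem aeval_jordanBlock_apply (m : ℕ) (μ : ℂ) (p : ℂ[X]) (i j : Fin m) :
    aeval (jordanBlock m μ) p i j =
      if i ≤ j then (hasseDeriv ((j : ℕ) - i) p).eval μ else 0 := by
  -- Shifting the eigenvalue to `0` replaces `p` by its Taylor expansion `p (X + μ)`.
  have hJ : jordanBlock m μ = aeval (jordanBlock m 0) (X + C μ) := by
    rw [map_add, aeval_X, aeval_C]
    ext i j
    rw [Matrix.add_apply, Matrix.algebraMap_matrix_apply]
    simp only [jordanBlock, Matrix.of_apply]
    split_ifs <;> simp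
  rw [hJ, ← aeval_comp, ← taylor_apply, ← taylor_coeff]
  generalize taylor μ p = q
  induction q using Polynomial.induction_on' with
  | add p q hp hq =>
    rw [map_add, Matrix.add_apply, hp, hq, coeff_add]
    split_ifs <;> simp
  | monomial d a =>
    rw [aeval_monomial, ← Algebra.smul_def, Matrix.smul_apply, jordanBlock_zero_pow_apply,
      coeff_monomial]
    by_cases h : i ≤ j
    · have h' : (i : ℕ) ≤ j := h
      rw [if_pos h]
      by_cases hd : (i : ℕ) + d = j
      · rw [if_pos hd, if_pos (by omega)]; simp
      · rw [if_neg hd, if_neg (by omega)]; simp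
    · have h' : ¬ (i : ℕ) ≤ j := h
      rw [if_neg h, if_neg (by omega)]; simp

/-- Polynomials of a matrix are computed on a Jordan canonical form. -/
theorem JordanForm.aeval_eq {n : ℕ} {A : Matrix (Fin n) (Fin n) ℂ} (J : JordanForm A)
    (p : ℂ[X]) :
    aeval A p =
      J.Z * (Matrix.blockDiagonal' fun k => aeval (jordanBlock (J.size k) (J.eig k)) p) *
        J.Zinv := by
  have hA : A = J.Z * (Matrix.blockDiagonal' fun k => jordanBlock (J.size k) (J.eig k)) *
      J.Zinv := by
    rw [← J.conj_eq]
    calc A = (J.Z * J.Zinv) * A * (J.Z * J.Zinv) := by rw [J.Z_mul_Zinv, one_mul, mul_one]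
      _ = _ := by simp only [Matrix.mul_assoc]
  have hpow : ∀ d : ℕ, A ^ d = J.Z * (Matrix.blockDiagonal' fun k =>
      jordanBlock (J.size k) (J.eig k)) ^ d * J.Zinv := by
    intro d
    induction d with
    | zero => rw [pow_zero, pow_zero, Matrix.mul_one, J.Z_mul_Zinv]
    | succ d ih =>
      calc A ^ (d + 1) = A ^ d * A := pow_succ _ _
        _ = (J.Z * (Matrix.blockDiagonal' fun k => jordanBlock (J.size k) (J.eig k)) ^ d *
            J.Zinv) * (J.Z * (Matrix.blockDiagonal' fun k => jordanBlock (J.size k) (J.eig k)) *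
            J.Zinv) := congrArg₂ _ ih hA
        _ = J.Z * (Matrix.blockDiagonal' fun k => jordanBlock (J.size k) (J.eig k)) ^ d *
            (J.Zinv * J.Z) * (Matrix.blockDiagonal' fun k => jordanBlock (J.size k) (J.eig k)) *
            J.Zinv := by simp only [Matrix.mul_assoc]
        _ = _ := by rw [J.Zinv_mul_Z, Matrix.mul_one, pow_succ]; simp only [Matrix.mul_assoc]
  induction p using Polynomial.induction_on' with
  | add p q hp hq =>
    simp only [map_add]
    rw [hp, hq, ← Matrix.add_mul, ← Matrix.mul_add, ← Matrix.blockDiagonal'_add]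
    rfl
  | monomial d a =>
    simp only [aeval_monomial, ← Algebra.smul_def]
    rw [hpow, ← Matrix.blockDiagonal'_pow]
    have : (Matrix.blockDiagonal' fun k => a • jordanBlock (J.size k) (J.eig k) ^ d)
        = a • Matrix.blockDiagonal' fun k => jordanBlock (J.size k) (J.eig k) ^ d :=
      Matrix.blockDiagonal'_smul a _
    rw [this, Matrix.mul_smul, Matrix.smul_mul]
    rfl

/-- The spectrum of a matrix similar to a block diagonal matrix whose blocks are upper triangular
with constant diagonal. -/
theorem mem_spectrum_conj_blockDiagonal'_iff {n p : ℕ} {size : Fin p → ℕ}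
    (hsize : ∀ k, 0 < size k)
    {Z : Matrix (Fin n) (Σ k, Fin (size k)) ℂ} {Zinv : Matrix (Σ k, Fin (size k)) (Fin n) ℂ}
    (hZ : Z * Zinv = 1) (hZ' : Zinv * Z = 1) {T : ∀ k, Matrix (Fin (size k)) (Fin (size k)) ℂ}
    {d : Fin p → ℂ} (hT : ∀ k, (T k).IsUpperTriangular) (hd : ∀ k i, T k i i = d k) {z : ℂ} :
    z ∈ spectrum ℂ (Z * Matrix.blockDiagonal' T * Zinv) ↔ ∃ k, d k = z := by
  classical
  -- In the lexicographic order the whole block diagonal matrix is upper triangular.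
  let _ : LinearOrder (Σ k, Fin (size k)) := LinearOrder.lift' toLex toLex.injective
  set M := Matrix.blockDiagonal' T with hM
  have h1 : algebraMap ℂ (Matrix (Fin n) (Fin n) ℂ) z - Z * M * Zinv
      = Z * (z • (1 : Matrix _ _ ℂ) - M) * Zinv := by
    rw [Matrix.mul_sub, Matrix.sub_mul, Matrix.mul_smul, Matrix.mul_one, Matrix.smul_mul, hZ,
      Algebra.algebraMap_eq_smul_one]
  have h2 : (z • (1 : Matrix _ _ ℂ) - M).det = ∏ x : (Σ k, Fin (size k)), (z - d x.1) := by
    rw [Matrix.det_of_isUpperTriangular]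
    · refine Finset.prod_congr rfl fun x _ => ?_
      obtain ⟨k, i⟩ := x
      simp [hM, Matrix.blockDiagonal'_apply_eq, hd]
    · rintro ⟨k, i⟩ ⟨l, j⟩ hlt
      have hlt' : toLex (⟨l, j⟩ : Σ k, Fin (size k)) < toLex ⟨k, i⟩ := hlt
      have hne : (⟨k, i⟩ : Σ k, Fin (size k)) ≠ ⟨l, j⟩ := by
        intro h; rw [h] at hlt'; exact lt_irrefl _ hlt'
      rw [Matrix.sub_apply, Matrix.smul_apply, Matrix.one_apply_ne hne, smul_zero, zero_sub,
        neg_eq_zero, hM]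
      by_cases hkl : k = l
      · subst hkl
        rw [Matrix.blockDiagonal'_apply_eq]
        refine hT k ?_
        rcases Sigma.lex_iff.mp hlt' with h | ⟨_, h⟩
        · exact absurd h (lt_irrefl _)
        · exact h
      · exact Matrix.blockDiagonal'_apply_ne _ _ _ hkl
  rw [spectrum.mem_iff, h1, Matrix.isUnit_iff_isUnit_det, Matrix.det_conj_of_mul_eq_one hZ hZ',
    h2, isUnit_iff_ne_zero, not_not, Finset.prod_eq_zero_iff]
  constructor
  · rintro ⟨x, -, hx⟩
    exact ⟨x.1, (sub_eq_zero.mp hx).symm⟩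
  · rintro ⟨k, hk⟩
    exact ⟨⟨k, ⟨0, hsize k⟩⟩, Finset.mem_univ _, by rw [hk, sub_self]⟩

theorem JordanForm.mem_spectrum_iff {n : ℕ} {A : Matrix (Fin n) (Fin n) ℂ} (J : JordanForm A)
    {z : ℂ} : z ∈ spectrum ℂ A ↔ ∃ k, J.eig k = z := by
  have h := J.aeval_eq X
  simp only [aeval_X] at h
  rw [show spectrum ℂ A = _ from congrArg (spectrum ℂ) h]
  refine mem_spectrum_conj_blockDiagonal'_iff J.size_pos J.Z_mul_Zinv J.Zinv_mul_Z ?_ ?_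
  · intro k i j hij
    have hij' : (j : ℕ) < i := hij
    simp only [jordanBlock, Matrix.of_apply]
    rw [if_neg (by omega), if_neg (by omega)]
  · intro k i
    simp [jordanBlock]

/-! ### The binomial series on the closed unit interval -/

theorem succ_mul_choose (α : ℝ) (k : ℕ) :
    ((k : ℝ) + 1) * Ring.choose α (k + 1) = Ring.choose α k * (α - k) := by
  have h1 := Ring.descPochhammer_eq_factorial_smul_choose α k
  have h2 := Ring.descPochhammer_eq_factorial_smul_choose α (k + 1)
  rw [descPochhammer_succ_right, smeval_mul, h1, Nat.factorial_succ] at h2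
  simp only [smeval_sub, smeval_X, pow_one, smeval_natCast, pow_zero, nsmul_eq_mul,
    Nat.cast_mul, Nat.cast_add, Nat.cast_one, mul_one] at h2
  have hk : (k ! : ℝ) ≠ 0 := by exact_mod_cast Nat.factorial_ne_zero k
  apply mul_left_cancel₀ hk
  linarith

/-- For `0 < α ≤ 1` all coefficients of `1 - (1 - x) ^ α` are nonnegative. -/
theorem neg_one_pow_mul_choose_nonneg {α : ℝ} (hα0 : 0 < α) (hα1 : α ≤ 1) (k : ℕ) :
    0 ≤ (-1) ^ k * Ring.choose α (k + 1) := by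
  induction k with
  | zero => simpa using hα0.le
  | succ k ih =>
    have h := succ_mul_choose α (k + 1)
    have h2 : ((k : ℝ) + 2) * ((-1) ^ (k + 1) * Ring.choose α (k + 1 + 1))
        = ((-1) ^ k * Ring.choose α (k + 1)) * (k + 1 - α) := by
      push_cast at h
      rw [pow_succ]
      linear_combination (-(-1) ^ k) * h
    have h3 : 0 ≤ ((-1) ^ k * Ring.choose α (k + 1)) * ((k : ℝ) + 1 - α) :=
      mul_nonneg ih (by have : (0 : ℝ) ≤ k := k.cast_nonneg; linarith)
    rw [← h2] at h3
    exact nonneg_of_mul_nonneg_right h3 (by positivity)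

theorem abs_choose_succ {α : ℝ} (hα0 : 0 < α) (hα1 : α ≤ 1) (k : ℕ) :
    |Ring.choose α (k + 1)| = (-1) ^ k * Ring.choose α (k + 1) := by
  rw [← abs_of_nonneg (neg_one_pow_mul_choose_nonneg hα0 hα1 k), abs_mul, abs_pow, abs_neg,
    abs_one, one_pow, one_mul]

theorem hasSum_choose_mul_neg_pow (α : ℝ) {x : ℝ} (hx0 : 0 ≤ x) (hx1 : x < 1) :
    HasSum (fun k => (-1) ^ k * Ring.choose α k * x ^ k) ((1 - x) ^ α) := by
  have h := (Real.one_add_rpow_hasFPowerSeriesOnBall_zero (a := α)).hasSum (y := -x)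
    (by rw [← ENNReal.ofReal_one, Metric.eball_ofReal]; simpa [abs_of_nonneg hx0] using hx1)
  rw [zero_add, ← sub_eq_add_neg] at h
  refine h.congr_fun ?_
  intro k
  simp only [binomialSeries_apply, List.ofFn_const, List.prod_replicate, smul_eq_mul, neg_pow x]
  ring

/-- For `0 < α ≤ 1` the coefficients of `1 - (1 - x) ^ α` sum to at most `1`, its supremum on
`[0, 1)`. -/
theorem sum_abs_choose_le_one {α : ℝ} (hα0 : 0 < α) (hα1 : α ≤ 1) (N : ℕ) :
    ∑ k ∈ Finset.range N, |Ring.choose α (k + 1)| ≤ 1 := by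
  have key : ∀ x ∈ Set.Ico (0 : ℝ) 1,
      ∑ k ∈ Finset.range N, |Ring.choose α (k + 1)| * x ^ (k + 1) ≤ 1 := by
    intro x hx
    have h := hasSum_choose_mul_neg_pow α hx.1 hx.2
    rw [← hasSum_nat_add_iff' 1] at h
    have h' := h.neg
    have hle := sum_le_hasSum (Finset.range N) (fun k _ => ?_) h'
    · have hpos : 0 ≤ (1 - x) ^ α := Real.rpow_nonneg (by linarith [hx.2]) _
      refine le_trans (le_of_eq (Finset.sum_congr rfl fun k _ => ?_)) (hle.trans ?_)
      · rw [abs_choose_succ hα0 hα1, pow_succ (-1 : ℝ)]; ring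
      · simp [hpos]
    · have := mul_nonneg (neg_one_pow_mul_choose_nonneg hα0 hα1 k) (pow_nonneg hx.1 (k + 1))
      rw [pow_succ (-1 : ℝ)]
      linarith
  -- A finite sum is continuous in `x`, so the bound persists at `x = 1`.
  have hc : Tendsto (fun x : ℝ => ∑ k ∈ Finset.range N, |Ring.choose α (k + 1)| * x ^ (k + 1))
      (𝓝[<] 1) (𝓝 (∑ k ∈ Finset.range N, |Ring.choose α (k + 1)| * 1 ^ (k + 1))) := by
    refine Tendsto.mono_left ?_ nhdsWithin_le_nhds
    exact Continuous.tendsto (by fun_prop) 1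
  simp only [one_pow, mul_one] at hc
  refine le_of_tendsto hc ?_
  filter_upwards [Ico_mem_nhdsLT (zero_lt_one' ℝ)] with x hx using key x hx

/-- The binomial series of `(1 - x) ^ α` converges to `0` at `x = 1`, by Abel's theorem. -/
theorem tendsto_sum_choose_neg_one {α : ℝ} (hα0 : 0 < α) (hα1 : α ≤ 1) :
    Tendsto (fun N => ∑ k ∈ Finset.range N, Ring.choose α k * (-1) ^ k) atTop (𝓝 0) := by
  have hs1 : Summable fun k => |Ring.choose α (k + 1)| :=
    summable_of_sum_range_le (fun _ => abs_nonneg _) (sum_abs_choose_le_one hα0 hα1)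
  have hs2 : Summable fun k => (-1) ^ k * Ring.choose α k := by
    refine (summable_nat_add_iff 1).mp (Summable.of_abs ?_)
    simpa [abs_mul] using hs1
  have h := hs2.hasSum.tendsto_sum_nat
  have h1 := Real.tendsto_tsum_powerSeries_nhdsWithin_lt h
  have h2 : Tendsto (fun x : ℝ => (1 - x) ^ α) (𝓝[<] 1) (𝓝 0) := by
    have : Tendsto (fun x : ℝ => (1 - x) ^ α) (𝓝 1) (𝓝 ((1 - 1) ^ α)) :=
      ((continuous_const.sub continuous_id).rpow_const fun _ => Or.inr hα0.le).tendsto 1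
    rw [sub_self, Real.zero_rpow hα0.ne'] at this
    exact this.mono_left nhdsWithin_le_nhds
  have h3 : (fun x : ℝ => ∑' k, (-1) ^ k * Ring.choose α k * x ^ k) =ᶠ[𝓝[<] 1]
      fun x => (1 - x) ^ α := by
    filter_upwards [Ico_mem_nhdsLT (zero_lt_one' ℝ)] with x hx
    exact (hasSum_choose_mul_neg_pow α hx.1 hx.2).tsum_eq
  rw [tendsto_nhds_unique (h1.congr' h3) h2] at h
  simpa only [mul_comm] using h

/-! ### Taylor polynomials of the power function -/

theorem principalPower_zero {α : ℝ} (hα : α ≠ 0) : principalPower α 0 = 0 :=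
  Complex.zero_cpow (by exact_mod_cast hα)

/-- The Taylor polynomials of `z ^ α` at the point `t > 0`; `N` is the number of terms. -/
noncomputable def powerTaylor (t α : ℝ) (N : ℕ) : ℝ[X] :=
  ∑ k ∈ Finset.range N, C (t ^ α * Ring.choose α k) * (C t⁻¹ * (X - C t)) ^ k

theorem aeval_powerTaylor {R : Type*} [Ring R] [Algebra ℝ R] (t α : ℝ) (N : ℕ) (a : R) :
    aeval a (powerTaylor t α N) = ∑ k ∈ Finset.range N,
      (t ^ α * Ring.choose α k) • (t⁻¹ • (a - algebraMap ℝ R t)) ^ k := by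
  simp [powerTaylor, Algebra.smul_def]

theorem aeval_powerTaylor_succ {R : Type*} [Ring R] [Algebra ℝ R] (t α : ℝ) (N : ℕ) (a : R) :
    aeval a (powerTaylor t α (N + 1)) = algebraMap ℝ R (t ^ α) + ∑ k ∈ Finset.range N,
      (t ^ α * Ring.choose α (k + 1)) • (t⁻¹ • (a - algebraMap ℝ R t)) ^ (k + 1) := by
  rw [aeval_powerTaylor, Finset.sum_range_succ', add_comm]
  simp [Algebra.algebraMap_eq_smul_one]

/-- On the closed disc of convergence the nonconstant terms of the series add up to at most the
constant term `t ^ α` in modulus. -/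
theorem norm_sub_aeval_powerTaylor_le {α t : ℝ} (hα0 : 0 < α) (hα1 : α ≤ 1) (ht : 0 < t) {z : ℂ}
    (hz : ‖z - t‖ ≤ t) (N : ℕ) :
    ‖((t ^ α : ℝ) : ℂ) - aeval z (powerTaylor t α (N + 1))‖ ≤ t ^ α := by
  have htα : 0 ≤ t ^ α := Real.rpow_nonneg ht.le _
  have hw : ‖t⁻¹ • (z - (t : ℂ))‖ ≤ 1 := by
    rw [norm_smul, Real.norm_of_nonneg (inv_nonneg.mpr ht.le), inv_mul_le_one₀ ht]
    exact hz
  rw [aeval_powerTaylor_succ]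
  simp only [Complex.coe_algebraMap]
  rw [sub_add_cancel_left, norm_neg]
  calc _ ≤ ∑ k ∈ Finset.range N, t ^ α * |Ring.choose α (k + 1)| := by
        refine norm_sum_le_of_le _ fun k _ => ?_
        rw [norm_smul, norm_pow, norm_mul, Real.norm_of_nonneg htα, Real.norm_eq_abs]
        exact mul_le_of_le_one_right (by positivity) (pow_le_one₀ (norm_nonneg _) hw)
    _ = t ^ α * ∑ k ∈ Finset.range N, |Ring.choose α (k + 1)| := by rw [Finset.mul_sum]
    _ ≤ t ^ α := mul_le_of_le_one_right htα (sum_abs_choose_le_one hα0 hα1 N)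

/-- The Taylor polynomials at `t` still converge at the boundary point `0` of the disc. -/
theorem tendsto_powerTaylor_zero {α t : ℝ} (hα0 : 0 < α) (hα1 : α ≤ 1) (ht : 0 < t) :
    Tendsto (fun N => aeval (0 : ℂ) (powerTaylor t α N)) atTop (𝓝 (principalPower α 0)) := by
  have h := ((tendsto_sum_choose_neg_one hα0 hα1).const_mul (t ^ α))
  rw [mul_zero] at h
  have h' := (Complex.continuous_ofReal.tendsto 0).comp h
  rw [principalPower_zero hα0.ne']
  simp only [Complex.ofReal_zero] at h'
  refine h'.congr fun N => ?_
  rw [aeval_powerTaylor, Function.comp_apply, Finset.mul_sum, Complex.ofReal_sum]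
  refine Finset.sum_congr rfl fun k _ => ?_
  have : t⁻¹ • ((0 : ℂ) - algebraMap ℝ ℂ t) = -1 := by
    simp [ht.ne']
  rw [this]
  simp [mul_assoc]

theorem tendstoLocallyUniformlyOn_powerTaylor (α : ℝ) {t : ℝ} (ht : 0 < t) :
    TendstoLocallyUniformlyOn (fun N (z : ℂ) => aeval z (powerTaylor t α N)) (principalPower α)
      atTop (Metric.ball (t : ℂ) t) := by
  have h :=
    (Complex.one_add_cpow_hasFPowerSeriesOnBall_zero (a := (α : ℂ))).tendstoLocallyUniformlyOn
  have h1 := h.comp (t := Metric.ball (t : ℂ) t) (fun z : ℂ => t⁻¹ • (z - (t : ℂ)))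
    (by
      intro z hz
      rw [← ENNReal.ofReal_one, Metric.eball_ofReal, mem_ball_zero_iff, norm_smul,
        Real.norm_of_nonneg (inv_nonneg.mpr ht.le), inv_mul_lt_one₀ ht]
      exact mem_ball_iff_norm.mp hz)
    (by fun_prop)
  have h2 := (uniformContinuous_const_smul (t ^ α : ℝ) (X := ℂ)).comp_tendstoLocallyUniformlyOn h1
  refine (h2.congr fun N z _ => ?_).congr_right fun z hz => ?_
  · rw [aeval_powerTaylor]
    simp only [Function.comp, FormalMultilinearSeries.partialSum, Finset.smul_sum]
    refine Finset.sum_congr rfl fun k _ => ?_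
    rw [binomialSeries_apply, List.ofFn_const, List.prod_replicate, ← Complex.ofReal_choose,
      mul_smul, smul_eq_mul, Complex.real_smul (x := Ring.choose α k), Complex.coe_algebraMap]
  · have hz0 : 1 + t⁻¹ • (z - (t : ℂ)) = ((t⁻¹ : ℝ) : ℂ) * z := by
      have : (t : ℂ) ≠ 0 := by exact_mod_cast ht.ne'
      rw [Complex.real_smul]; push_cast; field_simp; ring
    simp only [Function.comp, zero_add, hz0, principalPower]
    have hz1 : z ≠ 0 := by
      rintro rfl
      rw [mem_ball_iff_norm] at hz
      simp [abs_of_pos ht] at hz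
    have ht' : (0:ℝ) < t⁻¹ := inv_pos.mpr ht
    rw [Complex.cpow_def_of_ne_zero (mul_ne_zero (by exact_mod_cast ht'.ne') hz1),
      Complex.cpow_def_of_ne_zero hz1, Complex.log_ofReal_mul ht' hz1, Complex.real_smul,
      Real.rpow_def_of_pos ht, Real.log_inv, Complex.ofReal_exp, ← Complex.exp_add]
    congr 1
    push_cast
    ring

/-- All derivatives of the Taylor polynomials converge in the disc (Weierstrass). -/
theorem tendstoLocallyUniformlyOn_iteratedDeriv_powerTaylor (α : ℝ) {t : ℝ} (ht : 0 < t) (d : ℕ) :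
    TendstoLocallyUniformlyOn
      (fun N (z : ℂ) => ((derivative^[d]) ((powerTaylor t α N).map (algebraMap ℝ ℂ))).eval z)
      (iteratedDeriv d (principalPower α)) atTop (Metric.ball (t : ℂ) t) := by
  induction d with
  | zero =>
    rw [iteratedDeriv_zero]
    refine (tendstoLocallyUniformlyOn_powerTaylor α ht).congr fun N z _ => ?_
    simp [aeval_def, eval_map]
  | succ d ih =>
    have h := ih.deriv (.of_forall fun N => (Polynomial.differentiable _).differentiableOn)
      Metric.isOpen_ball
    rw [iteratedDeriv_succ]
    refine h.congr fun N z _ => ?_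
    rw [Function.comp_apply, Polynomial.deriv, Function.iterate_succ_apply']

/-- The entries of the Taylor polynomials of a Jordan block converge to those of the power of the
block, if the eigenvalue is inside the disc of convergence. -/
theorem tendsto_hasseDeriv_powerTaylor (α : ℝ) {t : ℝ} (ht : 0 < t) (d : ℕ) {z : ℂ}
    (hz : ‖z - t‖ < t) :
    Tendsto (fun N => (hasseDeriv d ((powerTaylor t α N).map (algebraMap ℝ ℂ))).eval z) atTop
      (𝓝 (iteratedDeriv d (principalPower α) z / (d ! : ℂ))) := by
  have h := (tendstoLocallyUniformlyOn_iteratedDeriv_powerTaylor α ht d).tendsto_at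
    (mem_ball_iff_norm.mpr hz)
  refine (h.div_const (d ! : ℂ)).congr fun N => ?_
  have hd : (d ! : ℂ) ≠ 0 := by exact_mod_cast Nat.factorial_ne_zero d
  rw [← factorial_smul_hasseDeriv, div_eq_iff hd]
  simp [mul_comm]

theorem derivExists_principalPower (α : ℝ) (j : ℕ) {z : ℂ} (hz : z ∈ Complex.slitPlane) :
    DerivExists (principalPower α) j z := by
  have hf : AnalyticOnNhd ℂ (principalPower α) Complex.slitPlane := fun w hw =>
    analyticAt_id.cpow analyticAt_const hw
  induction j generalizing z with
  | zero => trivial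
  | succ j ih =>
    refine ⟨?_, ?_⟩
    · filter_upwards [Complex.isOpen_slitPlane.mem_nhds hz] with w hw using ih hw
    · rw [iteratedDeriv_eq_iterate]
      exact ((hf.iterated_deriv j) z hz).differentiableAt

/-! ### Spectral radius and singular `M`-matrices -/

theorem spectralRadius_lt_top {n : ℕ} (M : Matrix (Fin n) (Fin n) ℂ) : spectralRadius ℂ M < ⊤ := by
  obtain ⟨C, hC⟩ := ((Matrix.finite_spectrum M).image (fun z => ‖z‖₊)).bddAbove
  refine lt_of_le_of_lt (iSup₂_le fun z hz => ?_) (ENNReal.coe_lt_top (r := C))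
  exact_mod_cast hC ⟨z, hz, rfl⟩

theorem norm_le_specRadius {n : ℕ} {B : Matrix (Fin n) (Fin n) ℝ} {z : ℂ}
    (hz : z ∈ spectrum ℂ (B.map Complex.ofReal)) : ‖z‖ ≤ specRadius B := by
  have h : (‖z‖₊ : ENNReal) ≤ spectralRadius ℂ (B.map Complex.ofReal) :=
    le_iSup₂ (f := fun k (_ : k ∈ spectrum ℂ (B.map Complex.ofReal)) => (‖k‖₊ : ENNReal)) z hz
  simpa [specRadius] using ENNReal.toReal_mono (spectralRadius_lt_top _).ne h

theorem specRadius_eq_of_mem {n : ℕ} {B : Matrix (Fin n) (Fin n) ℝ} {r : ℝ} (hr : 0 ≤ r)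
    (hmem : (r : ℂ) ∈ spectrum ℂ (B.map Complex.ofReal))
    (hle : ∀ z ∈ spectrum ℂ (B.map Complex.ofReal), ‖z‖ ≤ r) : specRadius B = r := by
  refine le_antisymm ?_ ?_
  · refine ENNReal.toReal_le_of_le_ofReal hr (iSup₂_le fun z hz => ?_)
    rw [← enorm_eq_nnnorm, ← ofReal_norm]
    exact ENNReal.ofReal_le_ofReal (hle z hz)
  · simpa [abs_of_nonneg hr] using norm_le_specRadius hmem

theorem mem_spectrum_smul_one_sub_iff {n : ℕ} (s z : ℂ) (B : Matrix (Fin n) (Fin n) ℂ) :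
    z ∈ spectrum ℂ (s • (1 : Matrix (Fin n) (Fin n) ℂ) - B) ↔ s - z ∈ spectrum ℂ B := by
  rw [spectrum.mem_iff, spectrum.mem_iff, ← IsUnit.neg_iff]
  simp only [Algebra.algebraMap_eq_smul_one, sub_smul]
  rw [show -(z • (1 : Matrix (Fin n) (Fin n) ℂ) - (s • 1 - B)) = s • 1 - z • 1 - B by abel]

theorem map_smul_one_sub {n : ℕ} (s : ℝ) (B : Matrix (Fin n) (Fin n) ℝ) :
    (s • (1 : Matrix (Fin n) (Fin n) ℝ) - B).map Complex.ofReal =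
      (s : ℂ) • (1 : Matrix (Fin n) (Fin n) ℂ) - B.map Complex.ofReal := by
  ext i j
  simp [Matrix.one_apply, apply_ite]

/-- For `s < t` the disc `|z - s| ≤ s` lies in the open disc `|z - t| < t`, except for the point `0`.
It contains the spectrum of `s I - B` if `s = ρ(B)`. -/
theorem norm_sub_lt_of_norm_sub_le {s t : ℝ} {z : ℂ} (hst : s < t) (hz : ‖z - s‖ ≤ s)
    (hz0 : z ≠ 0) : ‖z - t‖ < t := by
  have hs : 0 ≤ s := (norm_nonneg _).trans hz
  have h1 : ‖z - s‖ ^ 2 ≤ s ^ 2 := by gcongr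
  have h2 : 0 < z.re ^ 2 + z.im ^ 2 := by
    have := Complex.normSq_pos.mpr hz0
    rw [Complex.normSq_apply] at this
    nlinarith
  rw [Complex.sq_norm, Complex.normSq_apply] at h1
  simp only [Complex.sub_re, Complex.ofReal_re, Complex.sub_im, Complex.ofReal_im, sub_zero] at h1
  have hre : 0 < z.re := by
    by_contra! h
    nlinarith [mul_nonneg hs (neg_nonneg.mpr h)]
  refine lt_of_pow_lt_pow_left₀ 2 (hs.trans hst.le) ?_
  rw [Complex.sq_norm, Complex.normSq_apply]
  simp only [Complex.sub_re, Complex.ofReal_re, Complex.sub_im, Complex.ofReal_im, sub_zero]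
  nlinarith [mul_pos hre (sub_pos.mpr hst)]

theorem mem_slitPlane_of_norm_sub_lt {t : ℝ} {z : ℂ} (hz : ‖z - t‖ < t) :
    z ∈ Complex.slitPlane := by
  left
  have h := (Complex.abs_re_le_norm (z - t)).trans_lt hz
  rw [Complex.sub_re, Complex.ofReal_re, abs_lt] at h
  linarith [h.1]

/-! ### Taylor polynomials of a matrix -/

theorem pow_apply_nonneg {n : ℕ} {M : Matrix (Fin n) (Fin n) ℝ} (hM : ∀ i j, 0 ≤ M i j) (k : ℕ)
    (i j : Fin n) : 0 ≤ (M ^ k) i j := by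
  induction k generalizing i j with
  | zero => rw [pow_zero, Matrix.one_apply]; split_ifs <;> norm_num
  | succ k ih =>
    rw [pow_succ, Matrix.mul_apply]
    exact Finset.sum_nonneg fun l _ => mul_nonneg (ih i l) (hM l j)

/-- The entries of `t ^ α I - p(A)` are nonnegative, where `p` is a Taylor polynomial of
`z ^ α` at `t` and `t I - A` has nonnegative entries. -/
theorem aeval_powerTaylor_apply_le {n : ℕ} {A : Matrix (Fin n) (Fin n) ℝ} {α t : ℝ} (hα0 : 0 < α)
    (hα1 : α ≤ 1) (ht : 0 < t) (hA : ∀ i j, 0 ≤ (t • (1 : Matrix (Fin n) (Fin n) ℝ) - A) i j)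
    (N : ℕ) (i j : Fin n) :
    aeval A (powerTaylor t α (N + 1)) i j ≤ (t ^ α • (1 : Matrix (Fin n) (Fin n) ℝ)) i j := by
  rw [aeval_powerTaylor_succ, Algebra.algebraMap_eq_smul_one, Matrix.add_apply, Matrix.sum_apply]
  refine add_le_of_nonpos_right (Finset.sum_nonpos fun k _ => ?_)
  have hneg : t⁻¹ • (A - algebraMap ℝ (Matrix (Fin n) (Fin n) ℝ) t)
      = (-1 : ℝ) • t⁻¹ • (t • (1 : Matrix (Fin n) (Fin n) ℝ) - A) := by
    rw [Algebra.algebraMap_eq_smul_one, neg_one_smul, ← smul_neg, neg_sub]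
  rw [hneg, _root_.smul_pow, smul_smul, Matrix.smul_apply, smul_eq_mul]
  have hpow := pow_apply_nonneg (M := t⁻¹ • (t • (1 : Matrix (Fin n) (Fin n) ℝ) - A))
    (fun i j => mul_nonneg (inv_nonneg.mpr ht.le) (hA i j)) (k + 1) i j
  refine mul_nonpos_of_nonpos_of_nonneg ?_ hpow
  have h := mul_nonneg (Real.rpow_nonneg ht.le α) (neg_one_pow_mul_choose_nonneg hα0 hα1 k)
  rw [pow_succ]
  linarith

/-- The bound `|t ^ α - z ^ α| ≤ t ^ α` on the disc `|z - t| < t` and at its boundary point `0`. -/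
theorem norm_sub_principalPower_le {α t : ℝ} (hα0 : 0 < α) (hα1 : α ≤ 1) (ht : 0 < t) {z : ℂ}
    (hz : ‖z - t‖ < t ∨ z = 0) : ‖((t ^ α : ℝ) : ℂ) - principalPower α z‖ ≤ t ^ α := by
  have hlim : Tendsto (fun N => aeval z (powerTaylor t α N)) atTop (𝓝 (principalPower α z)) := by
    rcases hz with h | rfl
    · exact (tendstoLocallyUniformlyOn_powerTaylor α ht).tendsto_at (mem_ball_iff_norm.mpr h)
    · exact tendsto_powerTaylor_zero hα0 hα1 ht
  have hle : ‖z - t‖ ≤ t := by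
    rcases hz with h | rfl
    · exact h.le
    · simp [abs_of_pos ht]
  refine le_of_tendsto (((tendsto_add_atTop_iff_nat 1).mpr hlim).const_sub _).norm
    (.of_forall fun N => norm_sub_aeval_powerTaylor_le hα0 hα1 ht hle N)

/-- The Taylor polynomials of a matrix converge to the primary matrix function if every eigenvalue
is inside the disc of convergence, except possibly for a semisimple eigenvalue `0` on its
boundary. -/
theorem tendsto_aeval_powerTaylor {n : ℕ} {A : Matrix (Fin n) (Fin n) ℂ} (J : JordanForm A)
    {α t : ℝ} (hα0 : 0 < α) (hα1 : α ≤ 1) (ht : 0 < t)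
    (hJ : ∀ k, ‖J.eig k - t‖ < t ∨ J.eig k = 0 ∧ J.size k = 1) :
    Tendsto (fun N => aeval A (powerTaylor t α N)) atTop
      (𝓝 (J.Z * (Matrix.blockDiagonal' fun k =>
        jordanBlockFun (principalPower α) (J.size k) (J.eig k)) * J.Zinv)) := by
  have hblock : ∀ k, Tendsto (fun N => aeval (jordanBlock (J.size k) (J.eig k))
      ((powerTaylor t α N).map (algebraMap ℝ ℂ))) atTop
      (𝓝 (jordanBlockFun (principalPower α) (J.size k) (J.eig k))) := by
    intro k
    refine tendsto_pi_nhds.mpr fun i => tendsto_pi_nhds.mpr fun j => ?_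
    simp only [aeval_jordanBlock_apply, jordanBlockFun, Matrix.of_apply]
    split_ifs with hij
    · rcases hJ k with h | ⟨h, h1⟩
      · exact tendsto_hasseDeriv_powerTaylor α ht _ h
      · have h2 : (j : ℕ) - i = 0 := by omega
        rw [h2, h]
        simpa [aeval_def, eval_map] using tendsto_powerTaylor_zero hα0 hα1 ht
    · exact tendsto_const_nhds
  have hdiag : Tendsto (fun N => Matrix.blockDiagonal' fun k =>
      aeval (jordanBlock (J.size k) (J.eig k)) ((powerTaylor t α N).map (algebraMap ℝ ℂ))) atTop
      (𝓝 (Matrix.blockDiagonal' fun k =>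
        jordanBlockFun (principalPower α) (J.size k) (J.eig k))) :=
    ((continuous_id.matrix_blockDiagonal').tendsto _).comp (tendsto_pi_nhds.mpr hblock)
  have hconj : Continuous fun M : Matrix (Σ k, Fin (J.size k)) (Σ k, Fin (J.size k)) ℂ =>
      J.Z * M * J.Zinv := (continuous_const.matrix_mul continuous_id).matrix_mul continuous_const
  refine ((hconj.tendsto _).comp hdiag).congr fun N => ?_
  rw [Function.comp_apply, ← J.aeval_eq, aeval_map_algebraMap]

theorem aeval_map_ofReal {n : ℕ} (A : Matrix (Fin n) (Fin n) ℝ) (p : ℝ[X]) :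
    aeval (A.map Complex.ofReal) p = (aeval A p).map Complex.ofReal :=
  (Polynomial.aeval_algHom_apply (Complex.ofRealAm.mapMatrix) A p)

end FracPower

theorem mainTheorem2 {n : ℕ} (A : Matrix (Fin n) (Fin n) ℝ)
    (hA : FracPower.IsSingularMMatrix A)
    (h0 : FracPower.IsSemisimpleEigenvalue (A.map Complex.ofReal) 0)
    (α : ℝ) (hα0 : 0 < α) (hα1 : α ≤ 1) :
    ∃ F : Matrix (Fin n) (Fin n) ℝ,
      FracPower.IsMatrixFunction (FracPower.principalPower α)
        (A.map Complex.ofReal) (F.map Complex.ofReal) ∧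
      FracPower.IsSingularMMatrix F := by
  open FracPower Filter Polynomial in
  obtain ⟨s, B, hB, hs, hA⟩ := hA
  have hs0 : 0 ≤ s := hs ▸ ENNReal.toReal_nonneg
  have hdisc : ∀ z ∈ spectrum ℂ (A.map Complex.ofReal), ‖z - s‖ ≤ s := by
    intro z hz
    rw [hA, map_smul_one_sub, mem_spectrum_smul_one_sub_iff] at hz
    rw [norm_sub_rev]
    exact (norm_le_specRadius hz).trans hs.ge
  -- Any `t > s` will do.
  let t := s + 1
  have hst : s < t := lt_add_one s
  have ht : 0 < t := hs0.trans_lt hst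
  have htα : 0 ≤ t ^ α := Real.rpow_nonneg ht.le _
  obtain ⟨J⟩ := nonempty_jordanForm (A.map Complex.ofReal)
  have hJ : ∀ k, ‖J.eig k - t‖ < t ∨ J.eig k = 0 ∧ J.size k = 1 := by
    intro k
    by_cases hk : J.eig k = 0
    · exact Or.inr ⟨hk, h0.2 J k hk⟩
    · exact Or.inl (norm_sub_lt_of_norm_sub_le hst (hdisc _ (J.mem_spectrum_iff.mpr ⟨k, rfl⟩)) hk)
  set G := J.Z * (Matrix.blockDiagonal' fun k =>
    jordanBlockFun (principalPower α) (J.size k) (J.eig k)) * J.Zinv with hG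
  have hlim := tendsto_aeval_powerTaylor J hα0 hα1 ht hJ
  rw [← hG] at hlim
  have hlim_apply : ∀ i j, Tendsto (fun N => ((aeval A (powerTaylor t α N) i j : ℝ) : ℂ)) atTop
      (𝓝 (G i j)) := by
    intro i j
    refine (tendsto_pi_nhds.mp (tendsto_pi_nhds.mp hlim i) j).congr fun N => ?_
    rw [aeval_map_ofReal, Matrix.map_apply]
  -- Limits of real numbers being real, passing to real parts loses nothing.
  let F : Matrix (Fin n) (Fin n) ℝ := Matrix.of fun i j => (G i j).re
  have hlim_re : ∀ i j, Tendsto (fun N => aeval A (powerTaylor t α N) i j) atTop (𝓝 (F i j)) :=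
    fun i j => (Complex.continuous_re.tendsto _).comp (hlim_apply i j)
  have hFG : F.map Complex.ofReal = G := by
    ext i j
    exact tendsto_nhds_unique ((Complex.continuous_ofReal.tendsto _).comp (hlim_re i j))
      (hlim_apply i j)
  have hspec : ∀ z, z ∈ spectrum ℂ G ↔ ∃ k, principalPower α (J.eig k) = z := by
    intro z
    refine mem_spectrum_conj_blockDiagonal'_iff J.size_pos J.Z_mul_Zinv J.Zinv_mul_Z ?_ ?_
    · intro k i j hij
      exact if_neg (not_le.mpr hij)
    · intro k i
      simp [jordanBlockFun]
  refine ⟨F, ⟨J, ?_, hFG⟩, t ^ α, t ^ α • 1 - F, ?_, ?_, (sub_sub_cancel _ _).symm⟩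
  · intro k j hj
    rcases hJ k with h | ⟨-, h1⟩
    · exact derivExists_principalPower α j (mem_slitPlane_of_norm_sub_lt h)
    · have hj0 : j = 0 := by omega
      rw [hj0]
      trivial
  · intro i j
    rw [Matrix.sub_apply, sub_nonneg]
    refine le_of_tendsto ((tendsto_add_atTop_iff_nat 1).mpr (hlim_re i j)) (.of_forall fun N => ?_)
    refine aeval_powerTaylor_apply_le hα0 hα1 ht (fun i j => ?_) N i j
    have : t • (1 : Matrix (Fin n) (Fin n) ℝ) - A = (1 : Matrix (Fin n) (Fin n) ℝ) + B := by
      rw [hA, add_smul, one_smul]; abel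
    rw [this, Matrix.add_apply]
    refine add_nonneg ?_ (hB i j)
    rw [Matrix.one_apply]; split_ifs <;> norm_num
  · symm
    apply specRadius_eq_of_mem htα
    · rw [map_smul_one_sub, mem_spectrum_smul_one_sub_iff, hFG, sub_self, hspec]
      have h := h0.1.mem_spectrum
      rw [Matrix.spectrum_toLin', J.mem_spectrum_iff] at h
      obtain ⟨k, hk⟩ := h
      exact ⟨k, by rw [hk, principalPower_zero hα0.ne']⟩
    · intro z hz
      rw [map_smul_one_sub, mem_spectrum_smul_one_sub_iff, hFG, hspec] at hz
      obtain ⟨k, hk⟩ := hz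
      rw [show z = ((t ^ α : ℝ) : ℂ) - principalPower α (J.eig k) by rw [hk, sub_sub_cancel]]
      exact norm_sub_principalPower_le hα0 hα1 ht ((hJ k).imp_right And.left)
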